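/- Let $\mathfrak{R}$ be a W*-algebra, i.e. a complex C*-algebra that is isometrically isomorphic, as a Banach space, to the dual $(\mathfrak{R}_*)^*$ of a complex Banach space $\mathfrak{R}_*$; identify $\mathfrak{R}$ with $(\mathfrak{R}_*)^*$. Let $\mathcal{S}(\mathfrak{R})$ be the set of states on $\mathfrak{R}$, i.e. of linear functionals $\omega$ on $\mathfrak{R}$ with $\omega(A^*A)\ge 0$ for all $A\in\mathfrak{R}$ and $\|\omega\|=1$, and let $\mathcal{S}_N(\mathfrak{R})$ be the set of normal states, i.e. of those states $\omega$ for which there is $\hat\omega\in\mathfrak{R}_*$ with $\omega(A)=A(\hat\omega)$ for all $A\in\mathfrak{R}$. Then $\mathcal{S}_N(\mathfrak{R})$ is dense in $\mathcal{S}(\mathfrak{R})$ in the weak* topology, i.e. in the topology that $\mathcal{S}(\mathfrak{R})$ inherits from the topology of pointwise convergence on $\mathfrak{R}$ on the dual space $\mathfrak{R}^*$. -/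

import Mathlib

open scoped ComplexOrder

/-- The state space `S(A)` of a (not necessarily unital) C⋆-algebra `A`: the positive linear
functionals of norm one, as a subset of the dual of `A` with its weak-⋆ topology
(the topology of pointwise convergence on `A`).
The order on `ℂ` is the one where `0 ≤ z` means that `z` is real and nonnegative. -/
def stateSpace (A : Type*) [NonUnitalCStarAlgebra A] : Set (WeakDual ℂ A) :=
  {ω | (∀ a : A, 0 ≤ ω (star a * a)) ∧ ‖WeakDual.toStrongDual ω‖ = 1}

/-- The normal state space `S_N(R)` of a W⋆-algebra `R`, that is, of a C⋆-algebra `R` identified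
with the dual of a Banach space `X` (the predual) by the isometric isomorphism `Φ`:
the states `ω` that are given by evaluation at an element of the predual. -/
def normalStateSpace {R X : Type*} [NonUnitalCStarAlgebra R]
    [NormedAddCommGroup X] [NormedSpace ℂ X] (Φ : R ≃ₗᵢ[ℂ] StrongDual ℂ X) :
    Set (WeakDual ℂ R) :=
  {ω | ω ∈ stateSpace R ∧ ∃ x : X, ∀ A : R, ω A = Φ A x}

/-!
The normal states form a convex set, so by the Hahn–Banach theorem it is enough to show that for
every state `ω` and every `a` in the algebra there are normal states `ψ` with `Re (ψ a)` at least
`Re (ω a)` up to an arbitrarily small error. The argument needs neither the weak-⋆ continuity of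
the algebraic operations nor the weak-⋆ closedness of the positive cone.

The algebra has a unit: the unit ball is weak-⋆ compact, hence has an extreme point `v`, which is a
partial isometry with `(1 - v v⋆) x (1 - v⋆ v) = 0` for all `x`, and this makes any approximate unit
norm convergent (`IsExtremeInBall.exists_unit`). States are then exactly the functionals
of norm at most one with value `1` at the unit, so a normal state is an element `y` of the unit ball
of the predual with `1(y) = 1`.

Such elements are found through the smoothness of the norm of a C⋆-algebra at its unit
(`uniformlySmoothAt_one`): the difference quotients `(‖1 + s a‖ - 1) / s` converge as `s → 0`,
uniformly in `‖a‖ ≤ 1`. By a separation argument in the predual, this uniformity shows that an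
element of the unit ball at which the unit takes a value near `1` lies near elements at which it
takes a value still nearer to `1`. Iterating, one arrives at an element at which the unit is `1`
(`exists_near_of_re_apply_eq_one`). Starting from an element of the predual that almost norms
`1 + t a` for small `t`, one gets a normal state `ψ` with `Re (ψ a)` close to
`(‖1 + t a‖ - 1) / t ≥ Re (ω a)`.
-/

/-! ### Norm attainment in the predual at points of smoothness -/

section DualBanach

variable {X : Type*} [NormedAddCommGroup X] [NormedSpace ℂ X]

theorem exists_norm_le_one_lt_re_apply (f : StrongDual ℂ X) {r : ℝ} (hr : r < ‖f‖) :
    ∃ x : X, ‖x‖ ≤ 1 ∧ r < (f x).re := by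
  obtain ⟨x, hx, hrx⟩ := f.exists_lt_apply_of_lt_opNorm hr
  by_cases h0 : f x = 0
  · exact ⟨x, hx.le, by simpa [h0] using hrx⟩
  have hn : (‖f x‖ : ℂ) ≠ 0 := by simpa using h0
  refine ⟨(starRingEnd ℂ (f x) / ‖f x‖) • x, ?_, ?_⟩
  · rw [norm_smul, norm_div, RCLike.norm_conj, Complex.norm_real, norm_norm,
      div_self (by simpa using h0), one_mul]
    exact hx.le
  · have : (starRingEnd ℂ (f x) / ‖f x‖) * f x = (‖f x‖ : ℂ) := by
      rw [div_mul_eq_mul_div, Complex.conj_mul', sq, mul_div_assoc, div_self hn, mul_one]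
    rw [map_smul, smul_eq_mul, this, Complex.ofReal_re]
    exact hrx

/-- The norm is smooth at the unit vector `e`, uniformly in the directions `a` of norm at most one:
the difference quotient at step `s` exceeds the one at step `t` by at most `s / 2 + t`, even when
`t` is much smaller than `s`. For small `s` the quotient is thus close to its limit at `0`. The
constants are those that hold at the unit of a C⋆-algebra. -/
def UniformlySmoothAt {E : Type*} [NormedAddCommGroup E] [NormedSpace ℂ E] (e : E) : Prop :=
  ∀ a : E, ‖a‖ ≤ 1 → ∀ s t : ℝ, 0 < s → s ≤ 1 / 2 → 0 < t → t ≤ 1 / 2 →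
    (‖e + s • a‖ - 1) / s ≤ (‖e + t • a‖ - 1) / t + s / 2 + t

/-- A point of the unit ball at which `e` is nearly `1` lies near points of the unit ball at which
`e` is as near to `1` as desired; the distance does not depend on `δ`. Otherwise some `a` of norm
one would separate `x` from all points `y` with `Re (e y) ≥ 1 - δ`; but points almost norming
`e + t • a` for tiny `t` are of this kind, and smoothness bounds their value under `a` from below
by that of `x`. -/
theorem exists_near_of_re_apply_near_one {e : StrongDual ℂ X} (he : ‖e‖ = 1)
    (hsm : UniformlySmoothAt e) {s δ : ℝ} (hs : 0 < s) (hs' : s ≤ 1 / 2) (hδ : 0 < δ)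
    {x : X} (hx : ‖x‖ ≤ 1) (hxe : 1 - s ^ 2 / 2 ≤ (e x).re) :
    ∃ y : X, ‖y‖ ≤ 1 ∧ 1 - δ ≤ (e y).re ∧ dist x y ≤ 2 * s := by
  by_contra! H
  set C : Set X := {y | ‖y‖ ≤ 1 ∧ 1 - δ ≤ (e y).re} with hC
  have hconv : Convex ℝ C := by
    have h1 : Convex ℝ {y : X | ‖y‖ ≤ 1} := by
      simpa [Metric.closedBall, dist_zero_right] using convex_closedBall (0 : X) 1
    have h2 : Convex ℝ {y : X | 1 - δ ≤ (e y).re} :=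
      convex_halfSpace_ge (f := fun y => (e y).re)
        ⟨fun a b => by simp, fun c a => by simp⟩ _
    exact h1.inter h2
  obtain ⟨f, u, hfb, hfC⟩ := RCLike.geometric_hahn_banach_open (𝕜 := ℂ)
    (convex_ball x (2 * s)) Metric.isOpen_ball hconv (by
      rw [Set.disjoint_left]
      intro y hy hyC
      have := H y hyC.1 hyC.2
      rw [Metric.mem_ball, dist_comm] at hy
      linarith)
  simp only [RCLike.re_to_complex] at hfb hfC
  have hCne : ∃ y, y ∈ C := by
    obtain ⟨y, hy, hy'⟩ := exists_norm_le_one_lt_re_apply e (r := 1 - δ) (by linarith)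
    exact ⟨y, hy, hy'.le⟩
  have hf0 : 0 < ‖f‖ := by
    rw [norm_pos_iff]
    rintro rfl
    obtain ⟨y, hy⟩ := hCne
    have h1 := hfb x (Metric.mem_ball_self (by linarith))
    have h2 := hfC y hy
    simp at h1 h2
    linarith
  -- A step of length `9 / 5 * s` stays inside the ball of radius `2 * s`, and in a direction where
  -- `Re f` is `5 / 6 * ‖f‖` it gains `3 / 2 * s * ‖f‖`. The contradiction with smoothness needs a
  -- gain greater than `s * ‖f‖`.
  have hu : (f x).re + 3 / 2 * s * ‖f‖ ≤ u := by
    obtain ⟨z, hz, hz'⟩ := exists_norm_le_one_lt_re_apply f (r := 5 / 6 * ‖f‖) (by linarith)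
    have h1 := hfb (x + (9 / 5 * s) • z) (by
      rw [Metric.mem_ball, dist_eq_norm, add_sub_cancel_left, norm_smul, Real.norm_eq_abs,
        abs_of_pos (by positivity)]
      nlinarith)
    have h2 : (f (x + (9 / 5 * s) • z)).re = (f x).re + 9 / 5 * s * (f z).re := by
      rw [map_add, ContinuousLinearMap.map_smul_of_tower, Complex.add_re, Complex.real_smul,
        Complex.re_ofReal_mul]
    nlinarith
  set a : StrongDual ℂ X := -(‖f‖⁻¹ • f) with ha
  have hanorm : ‖a‖ ≤ 1 := by
    rw [ha, norm_neg, norm_smul, norm_inv, norm_norm, inv_mul_cancel₀ hf0.ne']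
  have haC : ∀ y ∈ C, (a y).re ≤ (a x).re - 3 / 2 * s := by
    intro y hy
    have h1 := hfC y hy
    have h2 : ‖f‖⁻¹ * ((f x).re + 3 / 2 * s * ‖f‖) ≤ ‖f‖⁻¹ * (f y).re := by
      gcongr; linarith
    have h3 : ‖f‖⁻¹ * (3 / 2 * s * ‖f‖) = 3 / 2 * s := by field_simp
    simp [ha]
    linarith
  obtain ⟨t, ht, ht2, htδ, hts⟩ : ∃ t : ℝ, 0 < t ∧ t ≤ 1 / 2 ∧ 3 * t ≤ δ ∧ 8 * t ≤ s :=
    ⟨min (1 / 2) (min (δ / 3) (s / 8)), by positivity, min_le_left _ _,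
      by have := (min_le_right (1 / 2) (min (δ / 3) (s / 8))).trans (min_le_left _ _); linarith,
      by have := (min_le_right (1 / 2) (min (δ / 3) (s / 8))).trans (min_le_right _ _); linarith⟩
  -- A point almost norming `e + t • a` lies in `C`, so the separation applies to it.
  obtain ⟨y, hy, hy'⟩ := exists_norm_le_one_lt_re_apply (e + t • a) (r := ‖e + t • a‖ - t ^ 2)
    (by have : 0 < t ^ 2 := by positivity
        linarith)
  have hre : ∀ (r : ℝ) (z : X), ((e + r • a) z).re = (e z).re + r * (a z).re := by
    intro r z; simp
  have hbd : ∀ (g : StrongDual ℂ X) (z : X), ‖z‖ ≤ 1 → (g z).re ≤ ‖g‖ := fun g z hz =>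
    (Complex.re_le_norm _).trans <| (g.le_opNorm z).trans <|
      mul_le_of_le_one_right (norm_nonneg _) hz
  have hey := hbd e y hy
  have hay := hbd a y hy
  have hax := hbd (e + s • a) x hx
  have hNt : 1 - t ≤ ‖e + t • a‖ := by
    have h1 := norm_sub_le (e + t • a) (t • a)
    rw [add_sub_cancel_right, norm_smul, Real.norm_eq_abs, abs_of_pos ht] at h1
    nlinarith
  rw [hre] at hy' hax
  have hyC : y ∈ C := ⟨hy, by nlinarith⟩
  have hayx := haC y hyC
  have h1 : (a x).re - s / 2 ≤ (‖e + s • a‖ - 1) / s := by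
    rw [le_div_iff₀ hs]; nlinarith
  have h2 : (‖e + t • a‖ - 1) / t ≤ t + (a x).re - 3 / 2 * s := by
    rw [div_le_iff₀ ht]; nlinarith
  linarith [hsm a hanorm s t hs hs' ht ht2]

/-- The approximation of `exists_near_of_re_apply_near_one`, iterated with `s` halved at each step,
gives a Cauchy sequence whose limit attains the value `1`. Completeness of `X` is used here. -/
theorem exists_near_of_re_apply_eq_one [CompleteSpace X] {e : StrongDual ℂ X} (he : ‖e‖ = 1)
    (hsm : UniformlySmoothAt e) {s : ℝ} (hs : 0 < s) (hs' : s ≤ 1 / 2)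
    {x : X} (hx : ‖x‖ ≤ 1) (hxe : 1 - s ^ 2 / 2 ≤ (e x).re) :
    ∃ y : X, ‖y‖ ≤ 1 ∧ 1 ≤ (e y).re ∧ dist x y ≤ 4 * s := by
  have hstep : ∀ (n : ℕ) (z : {z : X // ‖z‖ ≤ 1 ∧ 1 - (s / 2 ^ n) ^ 2 / 2 ≤ (e z).re}),
      ∃ w : {w : X // ‖w‖ ≤ 1 ∧ 1 - (s / 2 ^ (n + 1)) ^ 2 / 2 ≤ (e w).re},
        dist (z : X) w ≤ 4 * s / 2 / 2 ^ n := by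
    rintro n ⟨z, hz, hze⟩
    have hle : s / 2 ^ n ≤ s := div_le_self hs.le (one_le_pow₀ one_le_two)
    obtain ⟨w, hw, hwe, hzw⟩ := exists_near_of_re_apply_near_one he hsm (s := s / 2 ^ n)
      (δ := (s / 2 ^ (n + 1)) ^ 2 / 2) (by positivity) (hle.trans hs') (by positivity) hz hze
    exact ⟨⟨w, hw, hwe⟩, hzw.trans_eq (by ring)⟩
  choose g hg using hstep
  let u : (n : ℕ) → {z : X // ‖z‖ ≤ 1 ∧ 1 - (s / 2 ^ n) ^ 2 / 2 ≤ (e z).re} :=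
    fun n => Nat.rec ⟨x, hx, by simpa using hxe⟩ (fun n z => g n z) n
  have hu : ∀ n, dist (u n).1 (u (n + 1)).1 ≤ 4 * s / 2 / 2 ^ n := fun n => hg n (u n)
  obtain ⟨y, hy⟩ := cauchySeq_tendsto_of_complete (cauchySeq_of_le_geometric_two hu)
  refine ⟨y, le_of_tendsto' hy.norm fun n => (u n).2.1, ?_,
    dist_le_of_le_geometric_two_of_tendsto₀ hu hy⟩
  have h1 : Filter.Tendsto (fun n => (e (u n).1).re) Filter.atTop (nhds (e y).re) :=
    ((Complex.continuous_re.comp e.continuous).tendsto y).comp hy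
  have h2 : Filter.Tendsto (fun n : ℕ => 1 - (s / 2 ^ n) ^ 2 / 2) Filter.atTop (nhds 1) := by
    have h3 : Filter.Tendsto (fun n : ℕ => s / 2 ^ n) Filter.atTop (nhds 0) := by
      simpa [div_eq_mul_inv] using
        (tendsto_pow_atTop_nhds_zero_of_lt_one (r := (2 : ℝ)⁻¹) (by norm_num)
          (by norm_num)).const_mul s
    simpa using ((h3.pow 2).div_const 2).const_sub 1
  exact le_of_tendsto_of_tendsto' h2 h1 fun n => (u n).2.2

/-- If the difference quotients at `e` in the direction `a` are all at least `k`, then some point of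
the unit ball of `X` attains the norm of `e` and has `Re a` at least `k - η`: it is found near a
point almost norming `e + t • a` for small `t`, where `Re a` is almost `k` and `e` almost `1`. -/
theorem exists_re_apply_eq_one_le_re_apply [CompleteSpace X] {e : StrongDual ℂ X} (he : ‖e‖ = 1)
    (hsm : UniformlySmoothAt e) (a : StrongDual ℂ X) {k η : ℝ} (hη : 0 < η)
    (hk : ∀ t : ℝ, 0 < t → 1 + t * k ≤ ‖e + t • a‖) :
    ∃ y : X, ‖y‖ ≤ 1 ∧ 1 ≤ (e y).re ∧ k - η ≤ (a y).re := by
  have hre : ∀ (r : ℝ) (z : X), ((e + r • a) z).re = (e z).re + r * (a z).re := by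
    intro r z; simp
  have hbd : ∀ (g : StrongDual ℂ X) (z : X), (g z).re ≤ ‖g‖ * ‖z‖ := fun g z =>
    (Complex.re_le_norm _).trans (g.le_opNorm z)
  have ha := norm_nonneg a
  obtain ⟨s, hs, hs2, hsη⟩ : ∃ s : ℝ, 0 < s ∧ s ≤ 1 / 2 ∧ s * (8 * (‖a‖ + 1)) ≤ η :=
    ⟨min (1 / 2) (η / (8 * (‖a‖ + 1))), by positivity, min_le_left _ _,
      (le_div_iff₀ (by positivity)).1 (min_le_right _ _)⟩
  obtain ⟨t, ht, ht2, hts⟩ : ∃ t : ℝ, 0 < t ∧ t ≤ s ∧ t * (2 * (2 * ‖a‖ + 1)) ≤ s ^ 2 :=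
    ⟨min s (s ^ 2 / (2 * (2 * ‖a‖ + 1))), by positivity, min_le_left _ _,
      (le_div_iff₀ (by positivity)).1 (min_le_right _ _)⟩
  obtain ⟨x, hx, hx'⟩ := exists_norm_le_one_lt_re_apply (e + t • a) (r := ‖e + t • a‖ - t ^ 2)
    (by have : 0 < t ^ 2 := by positivity
        linarith)
  have hNt : 1 - t * ‖a‖ ≤ ‖e + t • a‖ := by
    have h1 := norm_sub_le (e + t • a) (t • a)
    rw [add_sub_cancel_right, norm_smul, Real.norm_eq_abs, abs_of_pos ht] at h1
    linarith
  have hex : (e x).re ≤ 1 := (hbd e x).trans (by rw [he, one_mul]; exact hx)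
  have hax : (a x).re ≤ ‖a‖ := (hbd a x).trans (mul_le_of_le_one_right ha hx)
  rw [hre] at hx'
  obtain ⟨y, hy, hye, hxy⟩ := exists_near_of_re_apply_eq_one he hsm hs hs2 hx (by nlinarith)
  refine ⟨y, hy, hye, ?_⟩
  have hkx : k - t ≤ (a x).re := by
    have := hk t ht
    by_contra! h
    nlinarith
  have hxy' : (a x).re - (a y).re ≤ ‖a‖ * (4 * s) := by
    rw [← Complex.sub_re, ← map_sub]
    exact (hbd a _).trans (by rw [← dist_eq_norm]; gcongr)
  nlinarith

end DualBanach

/-! ### Functionals on a unital C⋆-algebra and smoothness at the unit -/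

/-- With `H = a + star a`, the square of `‖1 + r • a‖` differs from `‖1 + r • H‖` by at most
`r ^ 2`.
For self-adjoint `H` the norm of `1 + r • H` is `1 + r * max (spectrum H)` as long as `1 + r • H` is
positive, so it is affine in `r`. -/
theorem uniformlySmoothAt_one (A : Type*) [CStarAlgebra A] [Nontrivial A] :
    UniformlySmoothAt (1 : A) := by
  let _ := CStarAlgebra.spectralOrder A
  have := CStarAlgebra.spectralOrderedRing A
  intro a ha s t hs hs' ht ht'
  set H : A := a + star a with hH
  have hHsa : IsSelfAdjoint H := IsSelfAdjoint.add_star_self a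
  have hHn : ‖H‖ ≤ 2 := (norm_add_le _ _).trans (by rw [norm_star]; linarith)
  have hexp : ∀ r : ℝ, star (1 + r • a) * (1 + r • a) = 1 + r • H + r ^ 2 • (star a * a) := by
    intro r
    simp only [star_add, star_one, star_smul, star_trivial, mul_add, add_mul, one_mul, mul_one,
      smul_mul_smul_comm, hH, smul_add, sq]
    abel
  have hsmall : ∀ r : ℝ, ‖r ^ 2 • (star a * a)‖ ≤ r ^ 2 := by
    intro r
    rw [norm_smul, Real.norm_eq_abs, abs_of_nonneg (sq_nonneg r), CStarRing.norm_star_mul_self]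
    nlinarith [norm_nonneg a, sq_nonneg r, mul_le_one₀ ha (norm_nonneg a) ha]
  have hupper : ‖1 + s • a‖ ^ 2 ≤ ‖1 + s • H‖ + s ^ 2 := by
    rw [sq, ← CStarRing.norm_star_mul_self, hexp]
    exact (norm_add_le _ _).trans (by gcongr; exact hsmall s)
  have hlower : ‖1 + t • H‖ ≤ ‖1 + t • a‖ ^ 2 + t ^ 2 := by
    have h1 := norm_sub_le (1 + t • H + t ^ 2 • (star a * a)) (t ^ 2 • (star a * a))
    rw [add_sub_cancel_right, ← hexp, CStarRing.norm_star_mul_self, ← sq] at h1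
    linarith [hsmall t]
  have hsH : ‖s • H‖ ≤ 1 := by
    rw [norm_smul, Real.norm_eq_abs, abs_of_pos hs]; nlinarith [norm_nonneg H]
  have htH : ‖t • H‖ ≤ 2 * t := by
    rw [norm_smul, Real.norm_eq_abs, abs_of_pos ht]; nlinarith [norm_nonneg H]
  have hpos : 0 ≤ 1 + s • H := by
    have h1 := (IsSelfAdjoint.smul (IsSelfAdjoint.all s) hHsa).neg_algebraMap_norm_le_self
    have h2 : algebraMap ℝ A ‖s • H‖ ≤ algebraMap ℝ A 1 := algebraMap_mono A hsH
    rw [map_one] at h2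
    have := (neg_le_neg h2).trans h1
    exact neg_le_iff_add_nonneg'.1 this
  set M := ‖1 + t • H‖ with hM
  have hM1 : 1 - 2 * t ≤ M := by
    have h1 := norm_sub_le (1 + t • H) (t • H)
    rw [add_sub_cancel_right, norm_one] at h1
    linarith
  have hHle : H ≤ algebraMap ℝ A ((M - 1) / t) := by
    have h1 : 1 + t • H ≤ algebraMap ℝ A M :=
      ((IsSelfAdjoint.one A).add
        (IsSelfAdjoint.smul (IsSelfAdjoint.all t) hHsa)).le_algebraMap_norm_self
    have h2 : t • H ≤ algebraMap ℝ A (M - 1) := by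
      rw [map_sub, map_one]; exact le_sub_iff_add_le'.2 h1
    have h3 := smul_le_smul_of_nonneg_left h2 (inv_nonneg.2 ht.le)
    rwa [inv_smul_smul₀ ht.ne', Algebra.smul_def, ← map_mul, inv_mul_eq_div] at h3
  have hnorm : ‖1 + s • H‖ ≤ 1 + s * ((M - 1) / t) := by
    have h0 : -2 ≤ (M - 1) / t := by rw [le_div_iff₀ ht]; linarith
    rw [CStarAlgebra.norm_le_iff_le_algebraMap _ (by nlinarith) hpos, map_add, map_one, map_mul,
      ← Algebra.smul_def]
    gcongr
  set p := (‖1 + s • a‖ - 1) / s with hp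
  set q := (‖1 + t • a‖ - 1) / t with hq
  have hps : ‖1 + s • a‖ = 1 + s * p := by rw [hp]; field_simp; ring
  have hqt : ‖1 + t • a‖ = 1 + t * q := by rw [hq]; field_simp; ring
  have hta : ‖t • a‖ ≤ t := by
    rw [norm_smul, Real.norm_eq_abs, abs_of_pos ht]; nlinarith
  have hq1 : q ≤ 1 := by
    rw [hq, div_le_one ht]
    have := norm_add_le (1 : A) (t • a)
    rw [norm_one] at this
    linarith
  have hq2 : -1 ≤ q := by
    rw [hq, le_div_iff₀ ht]
    have := norm_sub_le (1 + t • a) (t • a)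
    rw [add_sub_cancel_right, norm_one] at this
    linarith
  have hMq : (M - 1) / t ≤ 2 * q + t * q ^ 2 + t := by
    rw [div_le_iff₀ ht]; rw [hqt] at hlower; nlinarith
  rw [hps] at hupper
  have h1 : s * (2 * p) ≤ s * (2 * q + t * q ^ 2 + t + s) := by
    nlinarith [sq_nonneg (s * p)]
  have h2 := le_of_mul_le_mul_left h1 hs
  have h3 : q ^ 2 ≤ 1 := by nlinarith
  nlinarith

theorem apply_eq_one_of_norm_le_one {A : Type*} [CStarAlgebra A] {f : StrongDual ℂ A}
    (hf : ‖f‖ ≤ 1) (hf1 : 1 ≤ (f 1).re) : f 1 = 1 := by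
  rcases subsingleton_or_nontrivial A with _ | _
  · rw [Subsingleton.elim (1 : A) 0, map_zero] at hf1
    norm_num at hf1
  have h1 : ‖f 1‖ ≤ 1 := (f.le_opNorm 1).trans (by rwa [norm_one, mul_one])
  have h2 := Complex.sq_norm_sub_sq_re (f 1)
  have h3 : ‖f 1‖ ^ 2 ≤ 1 := by nlinarith [norm_nonneg (f 1)]
  have h4 : (f 1).re ≤ 1 := (Complex.re_le_norm _).trans h1
  have h5 : (f 1).im ^ 2 = 0 := by nlinarith [sq_nonneg (f 1).im]
  exact Complex.ext (le_antisymm h4 hf1) (by simpa using h5)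

/-- For real `t`, the C⋆-identity gives `‖h + t * I‖ ^ 2 ≤ ‖h‖ ^ 2 + t ^ 2`, while the imaginary
part of `f (h + t * I)` is `Im (f h) + t`. Letting `t` tend to `±∞` forces `Im (f h) = 0`. -/
theorem im_apply_eq_zero_of_isSelfAdjoint {A : Type*} [CStarAlgebra A] {f : StrongDual ℂ A}
    (hf : ‖f‖ ≤ 1) (hf1 : f 1 = 1) {h : A} (hh : IsSelfAdjoint h) : (f h).im = 0 := by
  rcases subsingleton_or_nontrivial A with _ | _
  · rw [Subsingleton.elim h 0, map_zero, Complex.zero_im]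
  have key : ∀ t : ℝ, 2 * t * (f h).im ≤ ‖h‖ ^ 2 := by
    intro t
    have h1 : star (h + (t * Complex.I) • (1 : A)) * (h + (t * Complex.I) • (1 : A))
        = h * h + ((t ^ 2 : ℝ) : ℂ) • (1 : A) := by
      have h2 : star (h + (t * Complex.I) • (1 : A)) = h - (t * Complex.I) • (1 : A) := by
        rw [star_add, star_smul, hh.star_eq, star_one]
        simp [sub_eq_add_neg]
      rw [h2, sub_mul, mul_add, mul_add, smul_mul_smul_comm, mul_smul_comm, smul_mul_assoc,
        mul_one, mul_one, one_mul]
      have h3 : (t * Complex.I) * (t * Complex.I) = -((t ^ 2 : ℝ) : ℂ) := by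
        rw [mul_mul_mul_comm, Complex.I_mul_I]; push_cast; ring
      rw [h3, neg_smul]
      abel
    have h4 : ‖h + (t * Complex.I) • (1 : A)‖ ^ 2 ≤ ‖h‖ ^ 2 + t ^ 2 := by
      rw [sq, ← CStarRing.norm_star_mul_self, h1]
      refine (norm_add_le _ _).trans ?_
      rw [norm_smul, Complex.norm_real, norm_one, mul_one, Real.norm_eq_abs,
        abs_of_nonneg (sq_nonneg t), sq ‖h‖]
      gcongr
      exact norm_mul_le _ _
    have h5 : ‖f (h + (t * Complex.I) • (1 : A))‖ ≤ ‖h + (t * Complex.I) • (1 : A)‖ :=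
      (f.le_opNorm _).trans (mul_le_of_le_one_left (norm_nonneg _) hf)
    have h6 : (f (h + (t * Complex.I) • (1 : A))).im = (f h).im + t := by
      rw [map_add, map_smul, hf1]; simp
    have h7 := (Complex.abs_im_le_norm _).trans h5
    rw [h6] at h7
    have h8 := pow_le_pow_left₀ (abs_nonneg _) h7 2
    rw [sq_abs] at h8
    nlinarith [sq_nonneg (f h).im]
  by_contra h0
  have := key ((‖h‖ ^ 2 + 1) / (2 * (f h).im))
  have h2 : 2 * ((‖h‖ ^ 2 + 1) / (2 * (f h).im)) * (f h).im = ‖h‖ ^ 2 + 1 := by field_simp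
  linarith

theorem apply_star_mul_self_nonneg_of_norm_le_one {A : Type*} [CStarAlgebra A]
    {f : StrongDual ℂ A} (hf : ‖f‖ ≤ 1) (hf1 : f 1 = 1) (a : A) : 0 ≤ f (star a * a) := by
  let _ := CStarAlgebra.spectralOrder A
  have := CStarAlgebra.spectralOrderedRing A
  set c := star a * a with hc
  have hcsa : IsSelfAdjoint c := IsSelfAdjoint.star_mul_self a
  have hc0 : 0 ≤ c := star_mul_self_nonneg a
  -- A positive `c` lies within `‖c‖` of the scalar `‖c‖`, which forces `Re (f c) ≥ 0`.
  have h1 : ‖algebraMap ℝ A ‖c‖ - c‖ ≤ ‖c‖ := by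
    rw [CStarAlgebra.norm_le_iff_le_algebraMap _ (norm_nonneg c)
      (sub_nonneg.2 hcsa.le_algebraMap_norm_self)]
    exact sub_le_self _ hc0
  have h2 : (f (algebraMap ℝ A ‖c‖ - c)).re ≤ ‖c‖ :=
    (Complex.re_le_norm _).trans <| (f.le_opNorm _).trans <|
      (mul_le_of_le_one_left (norm_nonneg _) hf).trans h1
  have h3 : f (algebraMap ℝ A ‖c‖) = ‖c‖ := by
    rw [Algebra.algebraMap_eq_smul_one, ContinuousLinearMap.map_smul_of_tower, hf1]; simp
  rw [map_sub, h3, Complex.sub_re, Complex.ofReal_re] at h2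
  exact Complex.nonneg_iff.2 ⟨by linarith, (im_apply_eq_zero_of_isSelfAdjoint hf hf1 hcsa).symm⟩

/-- A positive functional attains its norm at the unit, by the Cauchy–Schwarz inequality for the
form `(a, b) ↦ f (star a * b)`. -/
theorem norm_le_re_apply_one {A : Type*} [CStarAlgebra A] {f : StrongDual ℂ A}
    (hf : ∀ a : A, 0 ≤ f (star a * a)) : ‖f‖ ≤ (f 1).re := by
  let _ := CStarAlgebra.spectralOrder A
  have := CStarAlgebra.spectralOrderedRing A
  let g : A →ₚ[ℂ] ℂ := PositiveLinearMap.mk₀ f.toLinearMap fun x hx => by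
    obtain ⟨b, rfl⟩ := CStarAlgebra.nonneg_iff_eq_star_mul_self.1 hx
    exact hf b
  have hg : ∀ x, g x = f x := fun _ => rfl
  have h1 : 0 ≤ f 1 := by simpa using hf 1
  have hf1 : ‖f 1‖ = (f 1).re := (Complex.re_eq_norm.2 h1).symm
  have hn : ∀ a : A, ‖g.toPreGNS a‖ ^ 2 = ‖f (star a * a)‖ := by
    intro a
    have := g.preGNS_norm_sq (g.toPreGNS a)
    rw [PositiveLinearMap.ofPreGNS_toPreGNS, hg] at this
    rw [← this]; simp
  refine f.opNorm_le_bound (Complex.nonneg_iff.1 h1).1 fun a => ?_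
  have h2 := norm_inner_le_norm (𝕜 := ℂ) (g.toPreGNS 1) (g.toPreGNS a)
  rw [PositiveLinearMap.preGNS_inner_def, PositiveLinearMap.ofPreGNS_toPreGNS,
    PositiveLinearMap.ofPreGNS_toPreGNS, star_one, one_mul, hg] at h2
  have h3 := hn 1
  rw [star_one, one_mul, hf1] at h3
  have h4 : ‖g.toPreGNS a‖ ^ 2 ≤ (f 1).re * ‖a‖ ^ 2 := by
    rw [hn, ← hf1, sq, ← CStarRing.norm_star_mul_self]
    exact g.norm_apply_le_of_nonneg _ (star_mul_self_nonneg a)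
  have h5 := (Complex.nonneg_iff.1 h1).1
  refine h2.trans (abs_le_of_sq_le_sq' ?_ (by positivity)).2
  rw [mul_pow, h3, mul_pow]
  nlinarith

/-! ### Extreme points of the unit ball and existence of a unit -/

/-- `v` is an extreme point of the closed unit ball, in symmetric form: `v` lies in the ball, and it
is not the midpoint of two other points `v + w` and `v - w` of the ball. -/
def IsExtremeInBall {E : Type*} [NormedAddCommGroup E] (v : E) : Prop :=
  ‖v‖ ≤ 1 ∧ ∀ w : E, ‖v + w‖ ≤ 1 → ‖v - w‖ ≤ 1 → w = 0

section NonUnital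
variable {A : Type*} [NonUnitalCStarAlgebra A]

/-- For `a = star v * v` the element in the norm is `star u * u` with `u = v * (3 - a) / 2`. The
bound comes from `0 ≤ x * (3 - x) ^ 2 / 4 ≤ 1` on `[0, 1]`. -/
theorem norm_cubic_le_one {a : A} (ha : ∃ v : A, a = star v * v) (ha1 : ‖a‖ ≤ 1) :
    ‖(9 / 4 : ℝ) • a - (3 / 2 : ℝ) • (a * a) + (1 / 4 : ℝ) • (a * a * a)‖ ≤ 1 := by
  let _ := CStarAlgebra.spectralOrder A
  have := CStarAlgebra.spectralOrderedRing A
  have ha0 : 0 ≤ a := by obtain ⟨v, rfl⟩ := ha; exact star_mul_self_nonneg v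
  have hsa : IsSelfAdjoint a := .of_nonneg ha0
  have h : (9 / 4 : ℝ) • a - (3 / 2 : ℝ) • (a * a) + (1 / 4 : ℝ) • (a * a * a)
      = cfcₙ (fun x : ℝ =>
          (9 / 4 : ℝ) • x - (3 / 2 : ℝ) • (x * x) + (1 / 4 : ℝ) • (x * x * x)) a := by
    rw [cfcₙ_add (fun x : ℝ => (9 / 4 : ℝ) • x - (3 / 2 : ℝ) • (x * x))
        (fun x : ℝ => (1 / 4 : ℝ) • (x * x * x)) a,
      cfcₙ_sub (fun x : ℝ => (9 / 4 : ℝ) • x) (fun x : ℝ => (3 / 2 : ℝ) • (x * x)) a,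
      cfcₙ_smul (9 / 4 : ℝ) (fun x : ℝ => x) a, cfcₙ_smul (3 / 2 : ℝ) (fun x : ℝ => x * x) a,
      cfcₙ_smul (1 / 4 : ℝ) (fun x : ℝ => x * x * x) a,
      cfcₙ_mul (fun x : ℝ => x * x) (fun x : ℝ => x) a,
      cfcₙ_mul (fun x : ℝ => x) (fun x : ℝ => x) a, cfcₙ_id' ℝ a]
  rw [h]
  refine norm_cfcₙ_le fun x hx => ?_
  have hx0 : 0 ≤ x := quasispectrum_nonneg_of_nonneg a ha0 x hx
  have hx1 : x ≤ 1 :=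
    (Real.le_norm_self x).trans
      ((NonUnitalIsometricContinuousFunctionalCalculus.norm_quasispectrum_le a hx hsa).trans ha1)
  simp only [smul_eq_mul]
  rw [Real.norm_eq_abs, abs_le]
  -- `4 - x * (3 - x) ^ 2 = (1 - x) ^ 2 * (4 - x)`
  have h1 : 0 ≤ x * (3 - x) ^ 2 := by positivity
  have h2 : 0 ≤ (1 - x) ^ 2 * (4 - x) := mul_nonneg (sq_nonneg _) (by linarith)
  constructor <;> nlinarith

/-- An extreme point of the unit ball is a partial isometry: with `a = star v * v`, both
`v + (v - v * a) / 2` and `v - (v - v * a) / 2` lie in the unit ball. -/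
theorem IsExtremeInBall.mul_star_mul_self {v : A} (hv : IsExtremeInBall v) :
    v * (star v * v) = v := by
  set a := star v * v with ha
  have ha1 : ‖a‖ ≤ 1 := by
    rw [ha, CStarRing.norm_star_mul_self]; exact mul_le_one₀ hv.1 (norm_nonneg v) hv.1
  have hasa : star a = a := by rw [ha, star_mul, star_star]
  have hva : ‖v * a‖ ≤ 1 := (norm_mul_le _ _).trans (mul_le_one₀ hv.1 (norm_nonneg a) ha1)
  have h1 : ‖v + (1 / 2 : ℝ) • (v - v * a)‖ ≤ 1 := by
    have h2 : star (v + (1 / 2 : ℝ) • (v - v * a)) * (v + (1 / 2 : ℝ) • (v - v * a))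
        = (9 / 4 : ℝ) • a - (3 / 2 : ℝ) • (a * a) + (1 / 4 : ℝ) • (a * a * a) := by
      have h3 : v + (1 / 2 : ℝ) • (v - v * a) = (3 / 2 : ℝ) • v - (1 / 2 : ℝ) • (v * a) := by
        module
      have e1 : star v * (v * a) = a * a := by rw [← mul_assoc]
      have e2 : a * star v * v = a * a := by rw [mul_assoc]
      have e3 : a * star v * (v * a) = a * a * a := by rw [← mul_assoc, e2]
      rw [h3, star_sub, star_smul, star_smul, star_mul, hasa, star_trivial (3 / 2 : ℝ),
        star_trivial (1 / 2 : ℝ), sub_mul, mul_sub, mul_sub]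
      simp only [smul_mul_smul_comm, ← ha, e1, e2, e3]
      module
    have h4 : ‖v + (1 / 2 : ℝ) • (v - v * a)‖ * ‖v + (1 / 2 : ℝ) • (v - v * a)‖ ≤ 1 := by
      rw [← CStarRing.norm_star_mul_self, h2]
      exact norm_cubic_le_one ⟨v, ha⟩ ha1
    nlinarith [norm_nonneg (v + (1 / 2 : ℝ) • (v - v * a))]
  have h2 : ‖v - (1 / 2 : ℝ) • (v - v * a)‖ ≤ 1 := by
    have h3 : v - (1 / 2 : ℝ) • (v - v * a) = (1 / 2 : ℝ) • (v + v * a) := by module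
    rw [h3, norm_smul, Real.norm_of_nonneg (by norm_num)]
    linarith [norm_add_le v (v * a), hv.1]
  have h3 := hv.2 _ h1 h2
  rw [smul_eq_zero_iff_right (by norm_num), sub_eq_zero] at h3
  exact h3.symm

/-- A projection and a self-adjoint contraction orthogonal to it have a sum of norm at most one:
the `2 ^ k`-th power of the sum is `p + c ^ 2 ^ k`, of norm at most `2` for every `k`. -/
theorem norm_add_le_one_of_mul_eq_zero {p c : A} (hp : IsSelfAdjoint p) (hpp : p * p = p)
    (hc : IsSelfAdjoint c) (hpc : p * c = 0) (hp1 : ‖p‖ ≤ 1) (hc1 : ‖c‖ ≤ 1) : ‖p + c‖ ≤ 1 := by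
  have key : ∀ (k : ℕ) (c : A), IsSelfAdjoint c → p * c = 0 → ‖c‖ ≤ 1 →
      ‖p + c‖ ^ 2 ^ k ≤ 2 := by
    intro k
    induction k with
    | zero =>
      intro c _ _ hc1
      rw [pow_zero, pow_one]
      linarith [norm_add_le p c]
    | succ k ih =>
      intro c hc hpc hc1
      have hcp : c * p = 0 := by
        have := congrArg star hpc
        rwa [star_mul, hc.star_eq, hp.star_eq, star_zero] at this
      have hsq : (p + c) * (p + c) = p + c * c := by
        rw [add_mul, mul_add, mul_add, hpp, hpc, hcp, add_zero, zero_add]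
      rw [pow_succ', pow_mul, ← IsSelfAdjoint.norm_mul_self (hp.add hc), hsq]
      exact ih (c * c) (by rw [IsSelfAdjoint, star_mul, hc.star_eq])
        (by rw [← mul_assoc, hpc, zero_mul])
        ((norm_mul_le c c).trans (mul_le_one₀ hc1 (norm_nonneg c) hc1))
  by_contra! h
  obtain ⟨n, hn⟩ := pow_unbounded_of_one_lt 2 h
  exact (hn.trans_le (pow_le_pow_right₀ h.le n.lt_two_pow_self.le)).not_ge (key n c hc hpc hc1)

/-- With `p = star v * v` and `q = v * star v` this says `(1 - q) * x * (1 - p) = 0`, written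
without a unit: an element `y` of that corner in the unit ball satisfies `‖v ± y‖ ≤ 1`. -/
theorem IsExtremeInBall.eq_add_sub_corner {v : A} (hv : IsExtremeInBall v) (x : A) :
    x = v * star v * x + x * (star v * v) - v * star v * x * (star v * v) := by
  set p := star v * v with hp
  set q := v * star v with hq
  have hvp : v * p = v := hv.mul_star_mul_self
  have hqv : q * v = v := by rw [hq, mul_assoc, ← hp, hvp]
  have hps : star p = p := by rw [hp, star_mul, star_star]
  have hpp : p * p = p := by rw [hp, mul_assoc, ← hp, hvp]
  have hvq : star v * q = star v := by
    have := congrArg star hqv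
    rwa [star_mul, hq, star_mul, star_star, ← hq] at this
  -- It suffices to treat elements of the corner `(1 - q) A (1 - p)` that lie in the unit ball.
  suffices H : ∀ y : A, ‖y‖ ≤ 1 → star v * y = 0 → y * p = 0 → y = 0 by
    set y := x - q * x - x * p + q * x * p with hy
    have h1 : star v * y = 0 := by
      rw [hy]
      simp only [mul_add, mul_sub, ← mul_assoc, hvq]
      abel
    have h2 : y * p = 0 := by
      rw [hy]
      simp only [add_mul, sub_mul, mul_assoc, hpp]
      abel
    have h3 : y = 0 := by
      by_contra h0
      have hn : ‖y‖ ≠ 0 := by simpa using h0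
      have h4 := H (‖y‖⁻¹ • y)
        (by rw [norm_smul, norm_inv, norm_norm, inv_mul_cancel₀ hn])
        (by rw [mul_smul_comm, h1, smul_zero]) (by rw [smul_mul_assoc, h2, smul_zero])
      rw [smul_eq_zero] at h4
      exact h4.elim (inv_ne_zero hn) h0
    rw [hy] at h3
    rw [← sub_eq_zero, ← h3]
    abel
  intro y hy1 hvy hyp
  have hyv : star y * v = 0 := by
    have := congrArg star hvy
    rwa [star_mul, star_star, star_zero] at this
  have hpy : p * star y = 0 := by
    have := congrArg star hyp
    rwa [star_mul, hps, star_zero] at this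
  have hball : ‖p + star y * y‖ ≤ 1 := by
    refine norm_add_le_one_of_mul_eq_zero hps hpp (.star_mul_self y) ?_ ?_ ?_
    · rw [← mul_assoc, hpy, zero_mul]
    · rw [hp, CStarRing.norm_star_mul_self]; exact mul_le_one₀ hv.1 (norm_nonneg v) hv.1
    · rw [CStarRing.norm_star_mul_self]; exact mul_le_one₀ hy1 (norm_nonneg y) hy1
  apply hv.2
  · have h1 : star (v + y) * (v + y) = p + star y * y := by
      rw [star_add, add_mul, mul_add, mul_add, hvy, hyv, ← hp]; abel
    rw [← h1, CStarRing.norm_star_mul_self] at hball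
    nlinarith [norm_nonneg (v + y)]
  · have h1 : star (v - y) * (v - y) = p + star y * y := by
      rw [star_sub, sub_mul, mul_sub, mul_sub, hvy, hyv, ← hp]; abel
    rw [← h1, CStarRing.norm_star_mul_self] at hball
    nlinarith [norm_nonneg (v - y)]

/-- Apply `x = q * x + x * p - q * x * p` to an approximate unit: the right-hand side converges in
norm to `q + p - q * p`, so the approximate unit itself converges, and its limit is a unit. -/
theorem IsExtremeInBall.exists_unit {v : A} (hv : IsExtremeInBall v) :
    ∃ e : A, ∀ x : A, e * x = x ∧ x * e = x := by
  let _ := CStarAlgebra.spectralOrder A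
  have := CStarAlgebra.spectralOrderedRing A
  have hl := CStarAlgebra.increasingApproximateUnit A
  have := hl.neBot
  set p := star v * v
  set q := v * star v
  have hlim : Filter.Tendsto (fun x : A => x) (CStarAlgebra.approximateUnit A)
      (nhds (q + p - q * p)) := by
    have h1 := hl.tendsto_mul_left q
    have h2 := hl.tendsto_mul_right p
    refine ((h1.add h2).sub (h1.mul_const p)).congr fun x => ?_
    exact (hv.eq_add_sub_corner x).symm
  refine ⟨q + p - q * p, fun x => ⟨?_, ?_⟩⟩
  · exact tendsto_nhds_unique (hlim.mul_const x) (hl.tendsto_mul_right x)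
  · exact tendsto_nhds_unique (hlim.const_mul x) (hl.tendsto_mul_left x)

/-- The unital C⋆-algebra structure on a C⋆-algebra that has a two-sided unit `e`. Its underlying
non-unital C⋆-algebra is definitionally the given one. -/
abbrev CStarAlgebra.ofUnit (e : A) (he : ∀ x : A, e * x = x ∧ x * e = x) : CStarAlgebra A :=
  letI : NormedRing A :=
    { ‹NonUnitalCStarAlgebra A› with
      one := e
      one_mul := fun x => (he x).1
      mul_one := fun x => (he x).2 }
  letI : NormedAlgebra ℂ A :=
    { Algebra.ofModule (R := ℂ) (A := A) smul_mul_assoc mul_smul_comm with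
      norm_smul_le := norm_smul_le }
  { ‹NonUnitalCStarAlgebra A› with
    one := e
    one_mul := fun x => (he x).1
    mul_one := fun x => (he x).2
    algebraMap := algebraMap ℂ A
    commutes' := Algebra.commutes
    smul_def' := Algebra.smul_def }

end NonUnital

/-- The unit ball of a dual space is weak-⋆ compact, so the Krein–Milman theorem applies. -/
theorem exists_isExtremeInBall {R X : Type*} [NormedAddCommGroup R] [NormedSpace ℂ R]
    [NormedAddCommGroup X] [NormedSpace ℂ X] (Φ : R ≃ₗᵢ[ℂ] StrongDual ℂ X) :
    ∃ v : R, IsExtremeInBall v := by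
  have : LocallyConvexSpace ℝ (WeakDual ℂ X) :=
    inferInstanceAs (LocallyConvexSpace ℝ (WeakBilin (topDualPairing ℂ X)))
  obtain ⟨g, hg⟩ := (WeakDual.isCompact_closedBall (0 : StrongDual ℂ X) 1).extremePoints_nonempty
    ⟨0, by simp⟩
  have hmem : ∀ f : WeakDual ℂ X, f ∈ WeakDual.toStrongDual ⁻¹' Metric.closedBall 0 1 ↔
      ‖WeakDual.toStrongDual f‖ ≤ 1 := fun f => by simp
  refine ⟨Φ.symm (WeakDual.toStrongDual g), ?_, fun w hw1 hw2 => ?_⟩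
  · rw [Φ.symm.norm_map]; exact (hmem g).1 hg.1
  have h1 : StrongDual.toWeakDual (Φ (Φ.symm (WeakDual.toStrongDual g) + w)) = g := by
    refine hg.2 (x₂ := StrongDual.toWeakDual (Φ (Φ.symm (WeakDual.toStrongDual g) - w)))
      ((hmem _).2 ((Φ.norm_map _).trans_le hw1)) ((hmem _).2 ((Φ.norm_map _).trans_le hw2)) ?_
    refine ⟨1 / 2, 1 / 2, by norm_num, by norm_num, by norm_num, ?_⟩
    rw [map_add, map_sub, Φ.apply_symm_apply, map_add, map_sub]
    refine DFunLike.ext _ _ fun x => ?_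
    change (1 / 2 : ℝ) • (g x + Φ w x) + (1 / 2 : ℝ) • (g x - Φ w x) = g x
    module
  rw [map_add, Φ.apply_symm_apply, map_add] at h1
  have h2 : StrongDual.toWeakDual (Φ w) = 0 := add_eq_left.1 h1
  simpa using h2

/-! ### Density of the normal states -/

/-- The Hahn–Banach separation of a point from the closure of a convex set. Convexity is expressed
through the complex scalar multiplication, so that it does not depend on a choice of real module
structure on `E`. -/
theorem WithSeminorms.exists_re_lt_of_notMem_closure {E ι : Type*} [AddCommGroup E] [Module ℂ E]
    [TopologicalSpace E] [IsTopologicalAddGroup E] [ContinuousSMul ℂ E] {p : SeminormFamily ℂ E ι}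
    (hp : WithSeminorms p) {s : Set E}
    (hs : ∀ x ∈ s, ∀ y ∈ s, ∀ a b : ℝ, 0 ≤ a → 0 ≤ b → a + b = 1 →
      (a : ℂ) • x + (b : ℂ) • y ∈ s) {x : E} (hx : x ∉ closure s) :
    ∃ (f : StrongDual ℂ E) (u : ℝ), (∀ y ∈ s, (f y).re < u) ∧ u < (f x).re := by
  have : LocallyConvexSpace ℝ E := hp.toLocallyConvexSpace
  have : ContinuousSMul ℝ E := IsScalarTower.continuousSMul ℂ
  have hconv : Convex ℝ s := fun y hy z hz a b ha hb hab => hs y hy z hz a b ha hb hab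
  obtain ⟨f, u, hfu, huf⟩ := RCLike.geometric_hahn_banach_closed_point (𝕜 := ℂ)
    hconv.closure isClosed_closure hx
  exact ⟨f, u, fun y hy => hfu y (subset_closure hy), huf⟩

/-- The normal states of a unital C⋆-algebra form a convex set, since the norm of a positive
functional is its value at the unit. -/
theorem combination_mem_normalStateSpace {A X : Type*} [CStarAlgebra A] [Nontrivial A]
    [NormedAddCommGroup X] [NormedSpace ℂ X] (Φ : A ≃ₗᵢ[ℂ] StrongDual ℂ X) :
    ∀ ω ∈ normalStateSpace Φ, ∀ ψ ∈ normalStateSpace Φ, ∀ s t : ℝ, 0 ≤ s → 0 ≤ t → s + t = 1 →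
      (s : ℂ) • ω + (t : ℂ) • ψ ∈ normalStateSpace Φ := by
  rintro ω ⟨⟨hω, hωn⟩, x, hx⟩ ψ ⟨⟨hψ, hψn⟩, y, hy⟩ s t hs ht hst
  have happ : ∀ a : A, ((s : ℂ) • ω + (t : ℂ) • ψ) a = (s : ℂ) * ω a + (t : ℂ) * ψ a :=
    fun a => rfl
  have hpos : ∀ a : A, 0 ≤ ((s : ℂ) • ω + (t : ℂ) • ψ) (star a * a) := fun a => by
    rw [happ]
    exact add_nonneg (mul_nonneg (by exact_mod_cast hs) (hω a))
      (mul_nonneg (by exact_mod_cast ht) (hψ a))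
  refine ⟨⟨hpos, le_antisymm ?_ ?_⟩, (s : ℂ) • x + (t : ℂ) • y, fun a => ?_⟩
  · have h : WeakDual.toStrongDual ((s : ℂ) • ω + (t : ℂ) • ψ)
        = (s : ℂ) • WeakDual.toStrongDual ω + (t : ℂ) • WeakDual.toStrongDual ψ := rfl
    rw [h]
    refine (norm_add_le _ _).trans ?_
    rw [norm_smul, norm_smul, hωn, hψn, Complex.norm_real, Complex.norm_real,
      Real.norm_of_nonneg hs, Real.norm_of_nonneg ht]
    linarith
  · have h1 : 1 ≤ (ω 1).re := hωn ▸ norm_le_re_apply_one (f := WeakDual.toStrongDual ω) hω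
    have h2 : 1 ≤ (ψ 1).re := hψn ▸ norm_le_re_apply_one (f := WeakDual.toStrongDual ψ) hψ
    have h3 : 1 ≤ (((s : ℂ) • ω + (t : ℂ) • ψ) 1).re := by
      rw [happ, Complex.add_re, Complex.re_ofReal_mul, Complex.re_ofReal_mul]
      nlinarith
    have h4 := (WeakDual.toStrongDual ((s : ℂ) • ω + (t : ℂ) • ψ)).le_opNorm 1
    rw [norm_one, mul_one] at h4
    exact h3.trans ((Complex.re_le_norm _).trans h4)
  · rw [happ, hx, hy, map_add, map_smul, map_smul, smul_eq_mul, smul_eq_mul]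

/-- No `a` separates a state from the normal states: `Re (ω a)` is a lower bound for the difference
quotients of the norm at `1` in the direction `a`, and such a bound is reached, up to `η`, at a
point of the unit ball of `X` where the unit takes the value `1`. -/
theorem exists_mem_normalStateSpace_re_apply_ge {A X : Type*} [CStarAlgebra A] [Nontrivial A]
    [NormedAddCommGroup X] [NormedSpace ℂ X] [CompleteSpace X] (Φ : A ≃ₗᵢ[ℂ] StrongDual ℂ X)
    {ω : WeakDual ℂ A} (hω : ω ∈ stateSpace A) (a : A) {η : ℝ} (hη : 0 < η) :
    ∃ ψ ∈ normalStateSpace Φ, (ω a).re - η ≤ (ψ a).re := by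
  have he : ‖Φ 1‖ = 1 := by rw [Φ.norm_map, norm_one]
  have hsmul : ∀ (r : ℝ) (z : A), Φ (r • z) = r • Φ z := fun r z => by
    rw [← Complex.coe_smul, map_smul]; rfl
  have hsm : UniformlySmoothAt (Φ 1) := by
    intro b hb s t hs hs' ht ht'
    have h := uniformlySmoothAt_one A (Φ.symm b) (by rwa [Φ.symm.norm_map]) s t hs hs' ht ht'
    have h1 : ∀ r : ℝ, ‖Φ 1 + r • b‖ = ‖1 + r • Φ.symm b‖ := by
      intro r
      rw [← Φ.norm_map (1 + r • Φ.symm b), map_add, hsmul, Φ.apply_symm_apply]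
    rwa [h1, h1]
  obtain ⟨y, hy, hye, hya⟩ := exists_re_apply_eq_one_le_re_apply he hsm (Φ a) (k := (ω a).re) hη
    (fun t ht => by
      have h1 : 1 ≤ (ω 1).re := hω.2 ▸ norm_le_re_apply_one (f := WeakDual.toStrongDual ω) hω.1
      have h2 : Φ 1 + t • Φ a = Φ (1 + t • a) := by
        rw [map_add, hsmul]
      have h3 := (WeakDual.toStrongDual ω).le_opNorm (1 + t • a)
      rw [hω.2, one_mul] at h3
      have h4 : (ω (1 + t • a)).re = (ω 1).re + t * (ω a).re := by
        rw [map_add, ← Complex.coe_smul, map_smul, Complex.add_re, smul_eq_mul,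
          Complex.re_ofReal_mul]
      rw [h2, Φ.norm_map]
      have h5 : (ω (1 + t • a)).re ≤ ‖1 + t • a‖ := (Complex.re_le_norm _).trans h3
      linarith)
  set f : StrongDual ℂ A := (NormedSpace.inclusionInDoubleDual ℂ X y).comp
    (Φ.toContinuousLinearEquiv : A →L[ℂ] StrongDual ℂ X) with hf
  have hfa : ∀ b, f b = Φ b y := fun b => rfl
  have hfn : ‖f‖ ≤ 1 := f.opNorm_le_bound zero_le_one fun b => by
    rw [hfa, one_mul, ← Φ.norm_map b]
    exact ((Φ b).le_opNorm y).trans (mul_le_of_le_one_right (norm_nonneg _) hy)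
  have hf1 : f 1 = 1 := apply_eq_one_of_norm_le_one hfn hye
  refine ⟨StrongDual.toWeakDual f, ⟨⟨apply_star_mul_self_nonneg_of_norm_le_one hfn hf1,
    le_antisymm hfn ?_⟩, y, hfa⟩, hya⟩
  have h := f.le_opNorm 1
  rw [hf1, norm_one, norm_one, mul_one] at h
  exact h

theorem dense_normalStateSpace_of_unital {A X : Type*} [CStarAlgebra A]
    [NormedAddCommGroup X] [NormedSpace ℂ X] [CompleteSpace X] (Φ : A ≃ₗᵢ[ℂ] StrongDual ℂ X) :
    Dense {ω : stateSpace A | (ω : WeakDual ℂ A) ∈ normalStateSpace Φ} := by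
  intro ω
  rw [closure_subtype]
  -- In the zero algebra there is no functional of norm one.
  have : Nontrivial A := by
    by_contra h
    rw [not_nontrivial_iff_subsingleton] at h
    have h1 : WeakDual.toStrongDual (ω : WeakDual ℂ A) = 0 :=
      ContinuousLinearMap.ext fun a => by
        rw [Subsingleton.elim a 0, map_zero, map_zero]
    have h2 := ω.2.2
    rw [h1, norm_zero] at h2
    exact zero_ne_one h2
  have himg : Subtype.val '' {ω : stateSpace A | (ω : WeakDual ℂ A) ∈ normalStateSpace Φ}
      = normalStateSpace Φ := by
    ext ψ
    exact ⟨fun ⟨φ, hφ, h⟩ => h ▸ hφ, fun h => ⟨⟨ψ, h.1⟩, h, rfl⟩⟩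
  rw [himg]
  by_contra hω
  obtain ⟨f, u, hfu, huf⟩ := WithSeminorms.exists_re_lt_of_notMem_closure
    (WeakDual.withSeminorms ℂ A) (combination_mem_normalStateSpace Φ) hω
  obtain ⟨a, ha⟩ := LinearMap.dualEmbedding_surjective (topDualPairing ℂ A) f
  have hfa : ∀ ψ : WeakDual ℂ A, f ψ = ψ a := fun ψ => (DFunLike.congr_fun ha ψ).symm
  simp only [hfa] at hfu huf
  obtain ⟨ψ, hψ, hψa⟩ := exists_mem_normalStateSpace_re_apply_ge Φ ω.2 a (sub_pos.2 huf)
  have := hfu ψ hψ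
  linarith

theorem proposition4 {R X : Type*} [NonUnitalCStarAlgebra R]
    [NormedAddCommGroup X] [NormedSpace ℂ X] [CompleteSpace X]
    (Φ : R ≃ₗᵢ[ℂ] StrongDual ℂ X) :
    Dense {ω : stateSpace R | (ω : WeakDual ℂ R) ∈ normalStateSpace Φ} := by
  obtain ⟨v, hv⟩ := exists_isExtremeInBall Φ
  obtain ⟨e, he⟩ := hv.exists_unit
  let _ : CStarAlgebra R := CStarAlgebra.ofUnit e he
  exact dense_normalStateSpace_of_unital Φ
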